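/- Let $\mathcal{P}$ be the class of compact Lie groups that are isomorphic to a finite product of groups of the form $SU(r)$, $U(q)$ and $Sp(k)$, where $Sp(k)=Sp(2k,\mathbb{C})\cap U(2k)$ is the compact symplectic group. Let $G\in\mathcal{P}$, let $T\subset G$ be a maximal torus, and let $W=N_G(T)/T$ be its Weyl group. Let $\pi$ be a finitely generated abelian group, written in the form $\pi\cong\mathbb{Z}^n\oplus A$ with $n\ge 0$ and $A$ a finite abelian group. Give the set $\operatorname{Hom}(\pi,G)$ of group homomorphisms the topology of pointwise convergence; equivalently, the topology of a subspace of $G^m$, where $m$ generators of $\pi$ are chosen and a homomorphism is identified with the tuple of its values on them. Let $W$ act on the set $\operatorname{Hom}(A,T)$ of group homomorphisms by conjugation, $(w\cdot f)(a)=w\,f(a)\,w^{-1}$. Then $\operatorname{Hom}(A,T)$ is finite, $\operatorname{Hom}(\pi,G)$ has finitely many path-connected components, and the number of these components equals the number of $W$-orbits on $\operatorname{Hom}(A,T)$. -/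

import Mathlib

/-- The compact symplectic group `Sp(k) = Sp(2k, ℂ) ∩ U(2k)`, as a subgroup of `U(2k)`. -/
def compactSp (k : ℕ) : Subgroup (Matrix.unitaryGroup (Fin k ⊕ Fin k) ℂ) where
  carrier := {A | (A : Matrix (Fin k ⊕ Fin k) (Fin k ⊕ Fin k) ℂ) ∈
    Matrix.symplecticGroup (Fin k) ℂ}
  one_mem' := (Matrix.symplecticGroup (Fin k) ℂ).one_mem
  mul_mem' := fun ha hb => (Matrix.symplecticGroup (Fin k) ℂ).mul_mem ha hb
  inv_mem' := by
    intro A hA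
    have h1 : (A : Matrix (Fin k ⊕ Fin k) (Fin k ⊕ Fin k) ℂ) * (A⁻¹).1 = 1 :=
      congrArg Subtype.val (mul_inv_cancel A)
    have h2 : ((⟨A.1, hA⟩ : Matrix.symplecticGroup (Fin k) ℂ)⁻¹).1 * A.1 = 1 :=
      congrArg Subtype.val (inv_mul_cancel (⟨A.1, hA⟩ : Matrix.symplecticGroup (Fin k) ℂ))
    have h3 := left_inv_eq_right_inv h2 h1
    show (A⁻¹).1 ∈ Matrix.symplecticGroup (Fin k) ℂ
    rw [← h3]
    exact Subtype.property _

/-- The class `𝒫`: topological groups that are isomorphic (as topological groups, equivalently as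
Lie groups) to a finite product of groups `SU(r)`, `U(q)` and `Sp(k)`. -/
def InClassP (G : Type*) [Group G] [TopologicalSpace G] : Prop :=
  ∃ (a b c : ℕ) (r : Fin a → ℕ) (q : Fin b → ℕ) (k : Fin c → ℕ),
    Nonempty (G ≃ₜ*
      ((∀ i, Matrix.specialUnitaryGroup (Fin (r i)) ℂ) ×
       (∀ i, Matrix.unitaryGroup (Fin (q i)) ℂ) ×
       (∀ i, compactSp (k i))))

/-- The topology on `Hom(π, G)`, for a discrete group `π`: pointwise convergence. By
`homTopology_eq_induced_generators` it is the subspace topology from `G ^ m` given by any finite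
family of generators of `π`. -/
instance homTopology (π G : Type*) [Group π] [Group G] [TopologicalSpace G] :
    TopologicalSpace (π →* G) :=
  TopologicalSpace.induced (fun (f : π →* G) (x : π) => f x) inferInstance

theorem homTopology_eq_induced_generators {π G : Type*} [Group π] [Group G]
    [TopologicalSpace G] [IsTopologicalGroup G] {m : ℕ} (s : Fin m → π)
    (hs : Subgroup.closure (Set.range s) = ⊤) :
    homTopology π G =
      TopologicalSpace.induced (fun (f : π →* G) (i : Fin m) => f (s i)) inferInstance := by
  apply le_antisymm
  · rw [← continuous_iff_le_induced]
    refine continuous_pi fun i => ?_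
    exact (continuous_apply (s i)).comp continuous_induced_dom
  · unfold homTopology
    rw [← continuous_iff_le_induced]
    let _ : TopologicalSpace (π →* G) :=
      TopologicalSpace.induced (fun (f : π →* G) (i : Fin m) => f (s i)) inferInstance
    refine continuous_pi fun x => ?_
    have hx : x ∈ Subgroup.closure (Set.range s) := hs ▸ Subgroup.mem_top x
    induction hx using Subgroup.closure_induction with
    | mem x hx =>
      obtain ⟨i, rfl⟩ := hx
      exact (continuous_apply i).comp
        (continuous_induced_dom (f := fun (f : π →* G) (i : Fin m) => f (s i)))
    | one => simpa using continuous_const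
    | mul x y _ _ hx hy => simpa [Pi.mul_def] using hx.mul hy
    | inv x _ hx =>
      simp only [map_inv]
      exact continuous_inv.comp hx

/-- A torus in `G`: a subgroup isomorphic, as a topological group, to `(S¹) ^ k`. -/
def IsTorus {G : Type*} [Group G] [TopologicalSpace G] (T : Subgroup G) : Prop :=
  ∃ k : ℕ, Nonempty (T ≃ₜ* (Fin k → Circle))

/-- A maximal torus of `G`: a torus that is not properly contained in another torus. -/
structure MaximalTorus (G : Type*) [Group G] [TopologicalSpace G] where
  toSubgroup : Subgroup G
  maximal : Maximal IsTorus toSubgroup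

namespace MaximalTorus

variable {G : Type*} [Group G] [TopologicalSpace G] (T : MaximalTorus G)

theorem comm {x y : G} (hx : x ∈ T.toSubgroup) (hy : y ∈ T.toSubgroup) : x * y = y * x := by
  obtain ⟨k, ⟨e⟩⟩ := T.maximal.prop
  have h : (⟨x, hx⟩ * ⟨y, hy⟩ : T.toSubgroup) = ⟨y, hy⟩ * ⟨x, hx⟩ :=
    e.injective (by rw [map_mul, map_mul, mul_comm])
  exact congrArg Subtype.val h

/-- The normalizer `N_G(T)`. -/
abbrev normalizer : Subgroup G := Subgroup.normalizer (T.toSubgroup : Set G)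

/-- The Weyl group `W = N_G(T) / T`. -/
def WeylGroup : Type _ := T.normalizer ⧸ T.toSubgroup.subgroupOf T.normalizer

instance : Group T.WeylGroup :=
  inferInstanceAs (Group (T.normalizer ⧸ T.toSubgroup.subgroupOf T.normalizer))

/-- The conjugation action of `W` on `T`, as a homomorphism to the automorphism group of `T`. -/
def weylConj : T.WeylGroup →* MulAut T.toSubgroup :=
  QuotientGroup.lift (T.toSubgroup.subgroupOf T.normalizer) T.toSubgroup.normalizerMonoidHom (by
    intro g hg
    rw [Subgroup.normalizerMonoidHom_ker]
    exact Subgroup.mem_subgroupOf.mpr (Subgroup.mem_centralizer_iff.mpr fun x hx =>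
      T.comm hx (Subgroup.mem_subgroupOf.mp hg)))

/-- The action of `W` on `Hom(A, T)`: `(w • f) a = w (f a) w⁻¹`. -/
instance weylAction (A : Type*) [Group A] : MulAction T.WeylGroup (A →* T.toSubgroup) where
  smul w f := (T.weylConj w).toMonoidHom.comp f
  one_smul f := by
    show (T.weylConj 1).toMonoidHom.comp f = f
    rw [map_one]; rfl
  mul_smul v w f := by
    show (T.weylConj (v * w)).toMonoidHom.comp f =
      (T.weylConj v).toMonoidHom.comp ((T.weylConj w).toMonoidHom.comp f)
    rw [map_mul]; rfl

/-- The class in `W` of an element of the normalizer. -/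
def toWeyl (g : T.normalizer) : T.WeylGroup :=
  (QuotientGroup.mk g : T.normalizer ⧸ T.toSubgroup.subgroupOf T.normalizer)

theorem toWeyl_smul_apply {A : Type*} [Group A] (g : T.normalizer) (f : A →* T.toSubgroup)
    (a : A) : (((T.toWeyl g • f) a : T.toSubgroup) : G) = (g : G) * (f a : G) * (g : G)⁻¹ := rfl

end MaximalTorus

/-! In the groups considered, every commuting family can be conjugated into one fixed torus. For
$U(n)$ this is simultaneous diagonalization in an orthonormal basis, for $Sp(k)$ the same in a basis
$v_i, Jv_i$ adapted to the quaternionic structure. For $SU(n)$ it follows from $U(n)$, since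
determinants can be corrected by diagonal factors. In particular $G$ is path-connected, and
conjugation does not change the component of a homomorphism. The image of any $\pi\to G$ is
commutative, so it may be moved into $T$; there the $\mathbb{Z}^n$ part is contracted by scaling
logarithms. Hence every component contains a homomorphism $\pi\to A\to T$, and $W$-conjugate ones
lie in the same component.

Conversely, a path between two such homomorphisms restricts to a path in $\operatorname{Hom}(A,G)$.
Along it the image of each $a$ has order dividing $|A|$, so its trace takes finitely many values and
is constant (`conj_invariant_eq_of_joined`). Linear independence of characters then shows that the
diagonal characters at the two ends agree up to permutation, and for $Sp(k)$ up to permutation and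
inversion. A matrix normalizing the torus realizes this change.

`IsStandardTorus` records both properties. It is stable under products and isomorphisms, passes to
any maximal torus by `MaximalTorus.exists_isStandardTorus`, and yields the count in
`card_zerothHomotopy_hom`. -/

open Topology Filter Matrix
open scoped ComplexOrder

universe u

/-! ### The topology of the space of homomorphisms -/

section HomSpace

variable {π ρ G H : Type*} [Group π] [Group ρ] [Group G] [Group H]
  [TopologicalSpace G] [TopologicalSpace H]

theorem continuous_hom_eval (x : π) : Continuous fun f : π →* G => f x :=
  (continuous_apply x).comp continuous_induced_dom

theorem continuous_hom_iff {X : Type*} [TopologicalSpace X] {F : X → π →* G} :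
    Continuous F ↔ ∀ x, Continuous fun t => F t x := by
  rw [continuous_induced_rng, continuous_pi_iff]
  rfl

theorem continuous_hom_precomp (j : ρ →* π) : Continuous fun f : π →* G => f.comp j :=
  continuous_hom_iff.mpr fun x => continuous_hom_eval (j x)

theorem continuous_hom_postcomp (j : G →* H) (hj : Continuous j) :
    Continuous fun f : π →* G => j.comp f :=
  continuous_hom_iff.mpr fun x => hj.comp (continuous_hom_eval x)

/-- Conjugate homomorphisms into a path-connected group are joined by a path. -/
theorem joined_conj [IsTopologicalGroup G] [PathConnectedSpace G] (g : G) (f : π →* G) :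
    Joined f ((MulAut.conj g).toMonoidHom.comp f) := by
  have hc : Continuous fun h : G => (MulAut.conj h).toMonoidHom.comp f :=
    continuous_hom_iff.mpr fun x => by
      simp only [MonoidHom.comp_apply, MulEquiv.coe_toMonoidHom, MulAut.conj_apply]
      fun_prop
  have h := (PathConnectedSpace.joined (1 : G) g).map hc
  have h1 : (MulAut.conj (1 : G)).toMonoidHom.comp f = f := by ext; simp
  simpa only [h1] using h

end HomSpace

/-! ### Standard tori and their permanence properties -/

/-- Conjugation as an automorphism of a topological group. -/
def conjContinuousMulEquiv {G : Type*} [Group G] [TopologicalSpace G] [IsTopologicalGroup G]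
    (g : G) : G ≃ₜ* G where
  toMulEquiv := MulAut.conj g
  continuous_toFun := by
    change Continuous fun x => g * x * g⁻¹
    fun_prop
  continuous_invFun := by
    change Continuous fun x => g⁻¹ * x * g
    fun_prop

/-- A parametrized torus into which every commuting family can be conjugated, and in which
homomorphisms from finite abelian groups that are joined by a path in `Hom(A, G)` are conjugate by
an element normalizing the torus. -/
structure IsStandardTorus {G : Type*} [Group G] [TopologicalSpace G] {ι : Type}
    (φ : (ι → Circle) →* G) : Prop where
  continuous : Continuous φ
  injective : Function.Injective φ
  exists_conj_mem : ∀ S : Set G, (∀ x ∈ S, ∀ y ∈ S, x * y = y * x) →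
    ∃ g : G, ∀ x ∈ S, g * x * g⁻¹ ∈ φ.range
  exists_conj_eq : ∀ (A : Type u) [CommGroup A] [Finite A] (f g : A →* (ι → Circle)),
    Joined (φ.comp f) (φ.comp g) →
    ∃ n : G, (∀ z, n * φ z * n⁻¹ ∈ φ.range) ∧ ∀ a, φ (g a) = n * φ (f a) * n⁻¹

namespace IsStandardTorus

theorem map {G H : Type*} [Group G] [TopologicalSpace G] [Group H] [TopologicalSpace H]
    {ι : Type} {φ : (ι → Circle) →* G} (h : IsStandardTorus.{u} φ) (e : G ≃ₜ* H) :
    IsStandardTorus.{u} ((e : G →* H).comp φ) where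
  continuous := e.continuous_toFun.comp h.continuous
  injective := e.injective.comp h.injective
  exists_conj_mem S hS := by
    obtain ⟨g, hg⟩ := h.exists_conj_mem (e ⁻¹' S) fun x hx y hy =>
      e.injective (by simpa using hS _ hx _ hy)
    refine ⟨e g, fun x hx => ?_⟩
    obtain ⟨z, hz⟩ := hg (e.symm x) (by simpa using hx)
    exact ⟨z, by simp [hz]⟩
  exists_conj_eq A _ _ f g hfg := by
    have hj := hfg.map (continuous_hom_postcomp (π := A) (e.symm : H →* G) e.continuous_invFun)
    have key : ∀ f : A →* (ι → Circle),
        (e.symm : H →* G).comp (((e : G →* H).comp φ).comp f) = φ.comp f := fun f => by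
      ext; simp
    rw [key, key] at hj
    obtain ⟨n, hn, hn'⟩ := h.exists_conj_eq A f g hj
    refine ⟨e n, fun z => ?_, fun a => ?_⟩
    · obtain ⟨w, hw⟩ := hn z
      exact ⟨w, by simp [hw]⟩
    · simp [hn']

/-- Commuting sets and paths project to each factor, and the conjugating elements found there
assemble into a pair. -/
theorem prod {G H : Type*} [Group G] [TopologicalSpace G] [Group H] [TopologicalSpace H]
    {ι κ : Type} {φ : (ι → Circle) →* G} {ψ : (κ → Circle) →* H}
    (h : IsStandardTorus.{u} φ) (h' : IsStandardTorus.{u} ψ) :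
    ∃ Φ : (ι ⊕ κ → Circle) →* G × H, IsStandardTorus.{u} Φ := by
  let p : (ι ⊕ κ → Circle) →* (ι → Circle) := MonoidHom.pi fun i => Pi.evalMonoidHom _ (Sum.inl i)
  let q : (ι ⊕ κ → Circle) →* (κ → Circle) := MonoidHom.pi fun i => Pi.evalMonoidHom _ (Sum.inr i)
  have hpc : Continuous p := continuous_pi fun i => continuous_apply _
  have hqc : Continuous q := continuous_pi fun i => continuous_apply _
  have hpq : ∀ z w, p (Sum.elim z w) = z ∧ q (Sum.elim z w) = w := fun z w => ⟨rfl, rfl⟩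
  refine ⟨(φ.comp p).prod (ψ.comp q), ?_, ?_, ?_, ?_⟩
  · exact (h.continuous.comp hpc).prodMk (h'.continuous.comp hqc)
  · intro z w hzw
    have h1 : p z = p w := h.injective (congrArg Prod.fst hzw)
    have h2 : q z = q w := h'.injective (congrArg Prod.snd hzw)
    funext i
    cases i with
    | inl i => exact congrFun h1 i
    | inr i => exact congrFun h2 i
  · intro S hS
    obtain ⟨g, hg⟩ := h.exists_conj_mem (Prod.fst '' S) (by
      rintro _ ⟨x, hx, rfl⟩ _ ⟨y, hy, rfl⟩
      exact congrArg Prod.fst (hS x hx y hy))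
    obtain ⟨g', hg'⟩ := h'.exists_conj_mem (Prod.snd '' S) (by
      rintro _ ⟨x, hx, rfl⟩ _ ⟨y, hy, rfl⟩
      exact congrArg Prod.snd (hS x hx y hy))
    refine ⟨(g, g'), fun x hx => ?_⟩
    obtain ⟨z, hz⟩ := hg _ ⟨x, hx, rfl⟩
    obtain ⟨w, hw⟩ := hg' _ ⟨x, hx, rfl⟩
    exact ⟨Sum.elim z w, Prod.ext hz hw⟩
  · intro A _ _ f g hfg
    obtain ⟨n, hn, hn'⟩ := h.exists_conj_eq A (p.comp f) (p.comp g)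
      (hfg.map (continuous_hom_postcomp (MonoidHom.fst G H) continuous_fst))
    obtain ⟨m, hm, hm'⟩ := h'.exists_conj_eq A (q.comp f) (q.comp g)
      (hfg.map (continuous_hom_postcomp (MonoidHom.snd G H) continuous_snd))
    refine ⟨(n, m), fun z => ?_, fun a => Prod.ext (hn' a) (hm' a)⟩
    obtain ⟨z', hz⟩ := hn (p z)
    obtain ⟨w', hw⟩ := hm (q z)
    exact ⟨Sum.elim z' w', Prod.ext hz hw⟩

theorem pi {J : Type} {G : J → Type*} [∀ j, Group (G j)] [∀ j, TopologicalSpace (G j)]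
    {ι : J → Type} {φ : ∀ j, (ι j → Circle) →* G j} (h : ∀ j, IsStandardTorus.{u} (φ j)) :
    ∃ Φ : ((Σ j, ι j) → Circle) →* ∀ j, G j, IsStandardTorus.{u} Φ := by
  let p : ∀ j, ((Σ j, ι j) → Circle) →* (ι j → Circle) := fun j =>
    MonoidHom.pi fun i => Pi.evalMonoidHom _ ⟨j, i⟩
  have hpc : ∀ j, Continuous (p j) := fun j => continuous_pi fun i => continuous_apply _
  refine ⟨MonoidHom.pi fun j => (φ j).comp (p j), ?_, ?_, ?_, ?_⟩
  · exact continuous_pi fun j => (h j).continuous.comp (hpc j)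
  · intro z w hzw
    funext ⟨j, i⟩
    exact congrFun ((h j).injective (congrFun hzw j) : p j z = p j w) i
  · intro S hS
    have := fun j => (h j).exists_conj_mem ((fun x => x j) '' S) (by
      rintro _ ⟨x, hx, rfl⟩ _ ⟨y, hy, rfl⟩
      exact congrFun (hS x hx y hy) j)
    choose g hg using this
    refine ⟨g, fun x hx => ?_⟩
    choose z hz using fun j => hg j _ ⟨x, hx, rfl⟩
    exact ⟨fun i => z i.1 i.2, funext hz⟩
  · intro A _ _ f g hfg
    have := fun j => (h j).exists_conj_eq A ((p j).comp f) ((p j).comp g)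
      (hfg.map (continuous_hom_postcomp (Pi.evalMonoidHom G j) (continuous_apply j)))
    choose n hn hn' using this
    refine ⟨n, fun z => ?_, fun a => funext fun j => hn' j a⟩
    choose z' hz using fun j => hn j (p j z)
    exact ⟨fun i => z' i.1 i.2, funext hz⟩

section

variable {G : Type*} [Group G] [TopologicalSpace G] {ι : Type} {φ : (ι → Circle) →* G}

/-- A continuous bijection from a compact space to a Hausdorff space is a homeomorphism. -/
theorem isTorus_range [Finite ι] [T2Space G] (h : IsStandardTorus.{u} φ) : IsTorus φ.range := by
  obtain ⟨d, ⟨e⟩⟩ := Finite.exists_equiv_fin ι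
  have hc : Continuous φ.rangeRestrict := h.continuous.subtype_mk _
  have hb : Function.Bijective φ.rangeRestrict :=
    ⟨φ.rangeRestrict_injective_iff.mpr h.injective, φ.rangeRestrict_surjective⟩
  let E : (ι → Circle) ≃ₜ* φ.range :=
    { MulEquiv.ofBijective φ.rangeRestrict hb with
      continuous_toFun := hc
      continuous_invFun :=
        (Continuous.homeoOfEquivCompactToT2 (f := Equiv.ofBijective _ hb) hc).continuous_invFun }
  let R : (ι → Circle) ≃ₜ* (Fin d → Circle) :=
    { toFun := fun z i => z (e.symm i)
      invFun := fun z i => z (e i)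
      left_inv := fun z => by simp
      right_inv := fun z => by simp
      map_mul' := fun _ _ => rfl
      continuous_toFun := by fun_prop
      continuous_invFun := by fun_prop }
  exact ⟨d, ⟨E.symm.trans R⟩⟩

/-- Each single element is conjugate into the torus, where scaling arguments joins it to the
identity. -/
theorem pathConnectedSpace [IsTopologicalGroup G] (h : IsStandardTorus.{u} φ) :
    PathConnectedSpace G := by
  have h1 : ∀ x : G, Joined 1 x := fun x => by
    obtain ⟨g, hg⟩ := h.exists_conj_mem {x} (by rintro _ rfl _ rfl; rfl)
    obtain ⟨z, hz⟩ := hg x rfl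
    have hj : Joined (1 : ι → Circle) z := by
      have hs : ∀ i, ∃ θ : ℝ, Circle.exp θ = z i := fun i => Circle.exp_surjective (z i)
      choose θ hθ using hs
      refine ⟨⟨⟨fun t i => Circle.exp (t * θ i), by fun_prop⟩, ?_, ?_⟩⟩
      · ext i; simp
      · ext i; simp [hθ]
    have h2 := hj.map (f := fun z => g⁻¹ * φ z * g) (by have := h.continuous; fun_prop)
    simpa [hz, mul_assoc] using h2
  exact { nonempty := ⟨1⟩, joined := fun x y => (h1 x).symm.trans (h1 y) }

end

end IsStandardTorus

/-! ### Maximal tori and conjugation -/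

theorem IsTorus.map_conj {G : Type*} [Group G] [TopologicalSpace G] [IsTopologicalGroup G]
    {T : Subgroup G} (hT : IsTorus T) (g : G) : IsTorus (T.map (MulAut.conj g).toMonoidHom) := by
  obtain ⟨k, ⟨e⟩⟩ := hT
  let c := conjContinuousMulEquiv g
  let E : T ≃ₜ* T.map (MulAut.conj g).toMonoidHom :=
    { T.equivMapOfInjective _ (MulAut.conj g).injective with
      continuous_toFun := (c.continuous_toFun.comp continuous_subtype_val).subtype_mk _
      continuous_invFun := by
        refine continuous_induced_rng.mpr ?_
        refine (c.continuous_invFun.comp continuous_subtype_val).congr fun x => ?_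
        obtain ⟨y, rfl⟩ := (T.equivMapOfInjective _ (MulAut.conj g).injective).surjective x
        exact (c.left_inv y.1).trans
          (congrArg Subtype.val
            ((T.equivMapOfInjective _ (MulAut.conj g).injective).symm_apply_apply y).symm) }
  exact ⟨k, ⟨E.symm.trans e⟩⟩

namespace MaximalTorus

variable {G : Type*} [Group G] [TopologicalSpace G] [IsTopologicalGroup G]

/-- Conjugating `T₀` back by `g⁻¹` gives a torus containing `T`, so maximality forces equality. -/
theorem map_conj_eq_of_le (T : MaximalTorus G) {T₀ : Subgroup G} (hT₀ : IsTorus T₀) {g : G}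
    (hg : T.toSubgroup.map (MulAut.conj g).toMonoidHom ≤ T₀) :
    T.toSubgroup = T₀.map (MulAut.conj g⁻¹).toMonoidHom := by
  refine T.maximal.eq_of_le (hT₀.map_conj g⁻¹) fun t ht => ?_
  exact ⟨_, hg ⟨t, ht, rfl⟩, by simp [mul_assoc]⟩

/-- Only one inclusion is assumed; maximality supplies the reverse one. -/
theorem mem_normalizer_of_conj_mem (T : MaximalTorus G) {g : G}
    (hg : ∀ t ∈ T.toSubgroup, g * t * g⁻¹ ∈ T.toSubgroup) : g ∈ T.normalizer := by
  have h := T.map_conj_eq_of_le T.maximal.prop (g := g) (by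
    rintro _ ⟨t, ht, rfl⟩
    exact hg t ht)
  rw [Subgroup.mem_normalizer_iff]
  refine fun t => ⟨fun ht => hg t ht, fun ht => ?_⟩
  rw [h]
  exact ⟨_, ht, by simp [mul_assoc]⟩

/-- A maximal torus admits a standard parametrization as soon as some torus does. -/
theorem exists_isStandardTorus [T2Space G] (T : MaximalTorus G) {ι : Type} [Finite ι]
    {φ : (ι → Circle) →* G} (h : IsStandardTorus.{u} φ) :
    ∃ ψ : (ι → Circle) →* G, IsStandardTorus.{u} ψ ∧ ψ.range = T.toSubgroup := by
  obtain ⟨g, hg⟩ := h.exists_conj_mem T.toSubgroup fun x hx y hy => T.comm hx hy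
  have hT := T.map_conj_eq_of_le h.isTorus_range (g := g) (by
    rintro _ ⟨t, ht, rfl⟩
    exact hg t ht)
  refine ⟨_, h.map (conjContinuousMulEquiv g⁻¹), ?_⟩
  rw [hT, MonoidHom.range_comp]
  rfl

end MaximalTorus

/-! ### Torsion points of tori and logarithms -/

theorem finite_circle_pow_eq_one {ι : Type*} [Finite ι] {N : ℕ} (hN : N ≠ 0) :
    {z : ι → Circle | z ^ N = 1}.Finite := by
  have h1 : {z : Circle | z ^ N = 1}.Finite := by
    have h2 : {z : ℂ | z ^ N = 1}.Finite := by
      refine ((Polynomial.nthRootsFinset N (1 : ℂ)).finite_toSet).subset fun z hz => ?_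
      simpa [Polynomial.mem_nthRootsFinset (Nat.pos_of_ne_zero hN)] using hz
    refine Set.Finite.of_finite_image (f := ((↑) : Circle → ℂ)) (h2.subset ?_)
      Circle.coe_injective.injOn
    rintro _ ⟨z, hz, rfl⟩
    exact_mod_cast congrArg ((↑) : Circle → ℂ) hz
  refine (Set.Finite.pi' fun _ : ι => h1).subset fun z hz i => congrFun hz i

theorem finite_hom_of_finite_torsion {A T : Type*} [CommGroup A] [Finite A] [Group T]
    (hT : {t : T | t ^ Nat.card A = 1}.Finite) : Finite (A →* T) := by
  have := hT.to_subtype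
  refine Finite.of_injective (β := A → {t : T | t ^ Nat.card A = 1})
    (fun f a => ⟨f a, show f a ^ _ = 1 by rw [← map_pow, pow_card_eq_one', map_one]⟩) ?_
  intro f g hfg
  ext a
  exact congrArg Subtype.val (congrFun hfg a)

/-- Homomorphisms from a free abelian group to a torus have logarithms. -/
theorem exists_log_hom {n : ℕ} {ι : Type*} (h : Multiplicative (Fin n → ℤ) →* (ι → Circle)) :
    ∃ θ : (Fin n → ℤ) →+ (ι → ℝ), ∀ z i, h z i = Circle.exp (θ z.toAdd i) := by
  have hs : ∀ (j : Fin n) (i : ι), ∃ t : ℝ,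
      Circle.exp t = h (Multiplicative.ofAdd (Pi.single j 1)) i :=
    fun j i => Circle.exp_surjective _
  choose t ht using hs
  let θ : (Fin n → ℤ) →+ (ι → ℝ) :=
    ∑ j, ((zmultiplesHom (ι → ℝ)) (t j)).comp (Pi.evalAddMonoidHom (fun _ => ℤ) j)
  refine ⟨θ, fun z i => ?_⟩
  let k : Multiplicative (Fin n → ℤ) →* Circle :=
    AddMonoidHom.toMultiplicativeLeft
      (((Circle.expHom).comp (Pi.evalAddMonoidHom (fun _ => ℝ) i)).comp θ)
  have hk : (Pi.evalMonoidHom (fun _ => Circle) i).comp h = k := by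
    -- In additive form, extensionality reduces the claim to the basis vectors of `Fin n → ℤ`.
    apply MonoidHom.toAdditive.injective
    ext j
    simp [k, θ, ← ht]
  exact DFunLike.congr_fun hk z

/-! ### Counting components from a standard torus -/

section Main

variable {G : Type*} [Group G] [TopologicalSpace G] {ι : Type}
  {φ : (ι → Circle) →* G} {π A : Type*} [CommGroup π] [CommGroup A] {n : ℕ}

/-- A homomorphism to a torus is joined to its restriction to the torsion part. -/
theorem joined_comp_torsion (hφ : Continuous φ) (e : π ≃* Multiplicative (Fin n → ℤ) × A)
    (F : π →* (ι → Circle)) :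
    Joined (φ.comp F) (φ.comp ((F.comp (e.symm.toMonoidHom.comp (MonoidHom.inr _ A))).comp
      ((MonoidHom.snd (Multiplicative (Fin n → ℤ)) A).comp e.toMonoidHom))) := by
  obtain ⟨θ, hθ⟩ := exists_log_hom (F.comp (e.symm.toMonoidHom.comp (MonoidHom.inl _ A)))
  have hF : ∀ x : π, F x = F (e.symm ((e x).1, 1)) * F (e.symm (1, (e x).2)) := fun x => by
    rw [← map_mul, ← map_mul]; simp
  -- The logarithm of the free part is scaled by `t`: `L 1` is `F`, and `L 0` keeps only the torsion
  -- part.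
  let L : ℝ → π →* (ι → Circle) := fun t =>
    { toFun := fun x i => Circle.exp (t * θ (e x).1.toAdd i) * F (e.symm (1, (e x).2)) i
      map_one' := by
        ext i
        simp [Prod.one_eq_mk.symm]
      map_mul' := fun x y => by
        have : ((1 : Multiplicative (Fin n → ℤ)), (e x).2 * (e y).2) =
            (1, (e x).2) * (1, (e y).2) := by simp
        funext i
        simp only [map_mul, Prod.fst_mul, Prod.snd_mul, toAdd_mul, map_add, Pi.add_apply, mul_add,
          Circle.exp_add, this, Pi.mul_apply]
        exact mul_mul_mul_comm _ _ _ _ }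
  refine Joined.symm ⟨⟨⟨fun t => φ.comp (L t), ?_⟩, ?_, ?_⟩⟩
  · refine continuous_hom_iff.mpr fun x => hφ.comp ?_
    change Continuous fun t : unitInterval => fun i =>
      Circle.exp (t * θ (e x).1.toAdd i) * F (e.symm (1, (e x).2)) i
    fun_prop
  · have h0 : L 0 = (F.comp (e.symm.toMonoidHom.comp (MonoidHom.inr _ A))).comp
        ((MonoidHom.snd (Multiplicative (Fin n → ℤ)) A).comp e.toMonoidHom) := by
      ext x i
      simp [L]
    simpa using congrArg φ.comp h0
  · have h1 : L 1 = F := by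
      ext x i
      have := hθ (e x).1 i
      rw [hF x]
      simp only [MonoidHom.comp_apply] at this
      simp [L, ← this]
    simpa using congrArg φ.comp h1

theorem card_zerothHomotopy_hom [IsTopologicalGroup G] (T : MaximalTorus G) [Finite ι] {A : Type u} [CommGroup A]
    [Finite A] (h : IsStandardTorus.{u} φ)
    (hT : φ.range = T.toSubgroup) (e : π ≃* Multiplicative (Fin n → ℤ) × A) :
    Finite (A →* T.toSubgroup) ∧
    Finite (ZerothHomotopy (π →* G)) ∧
    Nat.card (ZerothHomotopy (π →* G)) =
      Nat.card (MulAction.orbitRel.Quotient T.WeylGroup (A →* T.toSubgroup)) := by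
  have := h.pathConnectedSpace
  have hfin : Finite (A →* T.toSubgroup) := by
    apply finite_hom_of_finite_torsion
    refine Set.Finite.of_finite_image (f := Subtype.val) ?_ Subtype.val_injective.injOn
    refine ((finite_circle_pow_eq_one (ι := ι) (N := Nat.card A) Nat.card_pos.ne').image φ).subset ?_
    rintro _ ⟨⟨t, ht⟩, ht', rfl⟩
    rw [← hT] at ht
    obtain ⟨z, rfl⟩ := ht
    refine ⟨z, h.injective ?_, rfl⟩
    rw [map_pow, map_one]
    exact congrArg Subtype.val ht'
  let p : π →* A := (MonoidHom.snd (Multiplicative (Fin n → ℤ)) A).comp e.toMonoidHom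
  let j : A →* π := e.symm.toMonoidHom.comp (MonoidHom.inr _ A)
  have hpj : p.comp j = MonoidHom.id A := by ext; simp [p, j]
  let Φ : (A →* T.toSubgroup) → (π →* G) := fun f => (T.toSubgroup.subtype.comp f).comp p
  have hlift : ∀ f : A →* T.toSubgroup, ∃ f' : A →* (ι → Circle),
      φ.comp f' = T.toSubgroup.subtype.comp f := fun f => by
    let E := MonoidHom.ofInjective h.injective
    refine ⟨(E.symm : φ.range →* _).comp ((Subgroup.inclusion hT.ge).comp f), ?_⟩
    ext a
    exact congrArg Subtype.val (E.apply_symm_apply _)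
  -- Being joined in `Hom(π, G)` is exactly Weyl equivalence: restriction along `j` and
  -- `exists_conj_eq` give one direction, path-connectedness of `G` the other.
  have hΦ : ∀ f g, Joined (Φ f) (Φ g) ↔ MulAction.orbitRel T.WeylGroup _ f g := by
    intro f g
    rw [MulAction.orbitRel_apply]
    constructor
    · intro hfg
      have h1 := hfg.map (continuous_hom_precomp j)
      obtain ⟨f', hf'⟩ := hlift f
      obtain ⟨g', hg'⟩ := hlift g
      have h2 : ∀ f, (Φ f).comp j = T.toSubgroup.subtype.comp f := fun f => by
        rw [MonoidHom.comp_assoc, hpj, MonoidHom.comp_id]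
      rw [h2, h2, ← hf', ← hg'] at h1
      -- The orbit relation asks for a Weyl element carrying `g` to `f`, hence the reversed path.
      obtain ⟨m, hm, hm'⟩ := h.exists_conj_eq A g' f' h1.symm
      have hmN : m ∈ T.normalizer := T.mem_normalizer_of_conj_mem fun t ht => by
        rw [← hT] at ht ⊢
        obtain ⟨z, rfl⟩ := ht
        exact hm z
      refine ⟨T.toWeyl ⟨m, hmN⟩, ?_⟩
      ext a
      have e1 : φ (f' a) = f a := DFunLike.congr_fun hf' a
      have e2 : φ (g' a) = g a := DFunLike.congr_fun hg' a
      change ((T.toWeyl ⟨m, hmN⟩ • g) a : G) = f a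
      rw [T.toWeyl_smul_apply, ← e1, ← e2, hm']
    · rintro ⟨w, rfl⟩
      obtain ⟨m, rfl⟩ : ∃ m, T.toWeyl m = w := QuotientGroup.mk_surjective w
      have h1 := joined_conj (m : G) (Φ g)
      exact h1.symm
  let Ψ : MulAction.orbitRel.Quotient T.WeylGroup (A →* T.toSubgroup) →
      ZerothHomotopy (π →* G) :=
    Quotient.lift (fun f => ZerothHomotopy.mk (Φ f)) fun f g hfg =>
      Quotient.sound ((hΦ f g).mpr hfg)
  have hΨ : Function.Bijective Ψ := by
    constructor
    · rintro ⟨f⟩ ⟨g⟩ hfg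
      exact Quotient.sound ((hΦ f g).mp (Quotient.exact hfg))
    · rintro ⟨F⟩
      obtain ⟨g, hg⟩ := h.exists_conj_mem (Set.range F) (by
        rintro _ ⟨x, rfl⟩ _ ⟨y, rfl⟩
        rw [← map_mul, ← map_mul, mul_comm])
      let E := MonoidHom.ofInjective h.injective
      let F' : π →* (ι → Circle) := (E.symm : φ.range →* _).comp
        (((MulAut.conj g).toMonoidHom.comp F).codRestrict φ.range fun x => hg _ ⟨x, rfl⟩)
      have hF' : φ.comp F' = (MulAut.conj g).toMonoidHom.comp F := by
        ext x
        exact congrArg Subtype.val (E.apply_symm_apply _)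
      have h1 := joined_conj g F
      rw [← hF'] at h1
      have h2 := h1.trans (joined_comp_torsion h.continuous e F')
      -- The preimage is the restriction to `A` of the conjugate of `F` lying in the torus.
      refine ⟨Quotient.mk _ (((φ.comp F').comp j).codRestrict T.toSubgroup fun a => ?_),
        Quotient.sound h2.symm⟩
      rw [← hT]
      exact ⟨_, rfl⟩
  have : Finite (MulAction.orbitRel.Quotient T.WeylGroup (A →* T.toSubgroup)) :=
    Quotient.finite _
  exact ⟨hfin, Finite.of_surjective Ψ hΨ.2, (Nat.card_congr (Equiv.ofBijective Ψ hΨ)).symm⟩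

end Main

/-! ### Rigidity along paths of homomorphisms -/

/-- A conjugation-invariant continuous function is constant along paths in `Hom(A, G)`, for `A`
finite. -/
theorem conj_invariant_eq_of_joined {G : Type*} [Group G] [TopologicalSpace G]
    {ι : Type} [Finite ι] {φ : (ι → Circle) →* G} (hφ : Function.Injective φ)
    (hconj : ∀ x, ∃ g, g * x * g⁻¹ ∈ φ.range) {τ : G → ℂ} (hτ : Continuous τ)
    (hinv : ∀ g x, τ (g * x * g⁻¹) = τ x) {A : Type*} [Group A] [Finite A] {f g : A →* G}
    (hfg : Joined f g) (a : A) : τ (f a) = τ (g a) := by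
  obtain ⟨γ⟩ := hfg
  let F : Set ℂ := (fun z => τ (φ z)) '' {z : ι → Circle | z ^ Nat.card A = 1}
  have hF : F.Finite := (finite_circle_pow_eq_one Nat.card_pos.ne').image _
  -- The element `γ t a` is killed by `Nat.card A`, so it is conjugate to one of the finitely many
  -- such points of the torus.
  have hmem : ∀ t, τ (γ t a) ∈ F := fun t => by
    obtain ⟨g, z, hz⟩ := hconj (γ t a)
    refine ⟨z, hφ ?_, ?_⟩
    · rw [map_pow, hz, conj_pow, ← map_pow, pow_card_eq_one', map_one, map_one]
      group
    · simp only
      rw [hz, hinv]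
  have hc : Continuous fun t => τ (γ t a) := hτ.comp ((continuous_hom_eval a).comp γ.continuous)
  have h := isPreconnected_univ.constant_of_mapsTo hF.isDiscrete hc.continuousOn
    (fun t _ => hmem t) (Set.mem_univ 0) (Set.mem_univ 1)
  simpa using h

/-! ### Recovering characters from their sums -/

section Combinatorics

variable {ι : Type*} [Fintype ι]

theorem exists_perm_of_card_fiber_eq {X : Type*} [DecidableEq X] {a b : ι → X}
    (h : ∀ x, (Finset.univ.filter fun i => a i = x).card =
      (Finset.univ.filter fun i => b i = x).card) :
    ∃ σ : Equiv.Perm ι, ∀ i, a (σ i) = b i := by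
  have E : ∀ x, Nonempty ({i // b i = x} ≃ {i // a i = x}) := fun x => by
    rw [← Fintype.card_eq, Fintype.card_subtype, Fintype.card_subtype, h]
  exact ⟨Equiv.ofFiberEquiv fun x => (E x).some, fun i => Equiv.ofFiberEquiv_map _ i⟩

/-- Families of unitary characters with the same sum agree up to a permutation. -/
theorem exists_perm_of_sum_character_eq {A : Type*} [CommGroup A] {χ ψ : ι → A →* Circle}
    (h : ∀ a, ∑ i, (χ i a : ℂ) = ∑ i, (ψ i a : ℂ)) :
    ∃ σ : Equiv.Perm ι, ∀ i, χ (σ i) = ψ i := by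
  classical
  apply exists_perm_of_card_fiber_eq
  -- By Dedekind independence the sum determines the multiplicity of every character, as a complex
  -- number and hence as a natural number.
  have hli : LinearIndependent ℂ fun (f : A →* Circle) (a : A) => (f a : ℂ) := by
    refine (linearIndependent_monoidHom A ℂ).comp
      (fun f : A →* Circle => Circle.coeHom.comp f) fun f g hfg => ?_
    ext a
    exact DFunLike.congr_fun hfg a
  have h1 : ∑ i, Finsupp.single (χ i) (1 : ℂ) = ∑ i, Finsupp.single (ψ i) (1 : ℂ) := by
    apply hli
    ext a
    simpa [map_sum] using h a
  intro x
  have h2 := DFunLike.congr_fun h1 x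
  simp only [Finsupp.finsetSum_apply, Finsupp.single_apply, Finset.sum_boole] at h2
  exact_mod_cast h2

/-- Families of unitary characters with the same sum of real parts agree up to a permutation and
inversions. -/
theorem exists_perm_of_sum_character_add_inv_eq {A : Type*} [CommGroup A] {χ ψ : ι → A →* Circle}
    (h : ∀ a, ∑ i, ((χ i a : ℂ) + ((χ i)⁻¹ a : Circle)) =
      ∑ i, ((ψ i a : ℂ) + ((ψ i)⁻¹ a : Circle))) :
    ∃ σ : Equiv.Perm ι, ∀ i, ψ i = χ (σ i) ∨ ψ i = (χ (σ i))⁻¹ := by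
  classical
  obtain ⟨τ, hτ⟩ := exists_perm_of_sum_character_eq
    (χ := Sum.elim χ fun i => (χ i)⁻¹) (ψ := Sum.elim ψ fun i => (ψ i)⁻¹) (fun a => by
      simpa [Finset.sum_add_distrib] using h a)
  -- Passing to the set `{x, x⁻¹}` makes every fibre of the doubled family exactly twice a fibre of
  -- the original one, including when `x = x⁻¹`.
  let q : (A →* Circle) → Set (A →* Circle) := fun x => {x, x⁻¹}
  have hq : ∀ x, q x⁻¹ = q x := fun x => by simp [q, Set.pair_comm]
  have hcard : ∀ (χ : ι → A →* Circle) y,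
      (Finset.univ.filter fun i => q (Sum.elim χ (fun i => (χ i)⁻¹) i) = y).card =
        2 * (Finset.univ.filter fun i => q (χ i) = y).card := fun χ y => by
    simp only [Finset.card_filter, Fintype.sum_sum_type, Sum.elim_inl, Sum.elim_inr, hq, two_mul]
    congr!
  obtain ⟨σ, hσ⟩ := exists_perm_of_card_fiber_eq (a := fun i => q (χ i)) (b := fun i => q (ψ i))
    (fun y => by
      refine Nat.eq_of_mul_eq_mul_left two_pos ?_
      rw [← hcard, ← hcard]
      refine (Finset.card_equiv τ fun i => ?_).symm
      simp [hτ])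
  refine ⟨σ, fun i => ?_⟩
  have : ψ i ∈ q (χ (σ i)) := by rw [hσ]; exact Or.inl rfl
  simpa [q] using this

end Combinatorics

/-! ### Common eigenvectors of commuting matrices -/

section Eigenvectors

/-- Commuting endomorphisms have a common eigenvector in any nonzero invariant subspace. -/
theorem exists_common_eigenvector {V : Type*} [AddCommGroup V] [Module ℂ V] [FiniteDimensional ℂ V]
    (S : Set (Module.End ℂ V)) (hS : ∀ s ∈ S, ∀ t ∈ S, s * t = t * s) (W : Submodule ℂ V)
    (hW : W ≠ ⊥) (hinv : ∀ s ∈ S, ∀ w ∈ W, s w ∈ W) :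
    ∃ v ∈ W, v ≠ 0 ∧ ∀ s ∈ S, ∃ c : ℂ, s v = c • v := by
  -- If some `s` is not scalar on `W`, an eigenspace of `s` in `W` is nonzero, strictly smaller, and
  -- invariant because the family commutes.
  induction W using WellFoundedLT.induction with
  | ind W ih =>
    by_cases hsc : ∀ s ∈ S, ∃ c : ℂ, ∀ w ∈ W, s w = c • w
    · obtain ⟨v, hv, hv0⟩ := W.exists_mem_ne_zero_of_ne_bot hW
      exact ⟨v, hv, hv0, fun s hs => (hsc s hs).imp fun c hc => hc v hv⟩
    · push Not at hsc
      obtain ⟨s, hs, hns⟩ := hsc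
      have : Nontrivial W := Submodule.nontrivial_iff_ne_bot.mpr hW
      obtain ⟨c, hc⟩ := Module.End.exists_eigenvalue (s.restrict (hinv s hs))
      obtain ⟨⟨w, hw⟩, hwe⟩ := hc.exists_hasEigenvector
      have hsw : s w = c • w := congrArg Subtype.val hwe.apply_eq_smul
      obtain ⟨v, hv, hv'⟩ := ih (W ⊓ Module.End.eigenspace s c) (by
          refine lt_of_le_of_ne inf_le_left fun h => ?_
          obtain ⟨x, hx, hxc⟩ := hns c
          exact hxc (Module.End.mem_eigenspace_iff.mp (inf_eq_left.mp h hx)))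
        ((Submodule.ne_bot_iff _).mpr
          ⟨w, ⟨hw, Module.End.mem_eigenspace_iff.mpr hsw⟩, fun h => hwe.2 (Subtype.ext h)⟩)
        (fun t ht x hx => ⟨hinv t ht x hx.1, by
          have h1 := Module.End.mem_eigenspace_iff.mp hx.2
          refine Module.End.mem_eigenspace_iff.mpr ?_
          have h2 := LinearMap.congr_fun (hS s hs t ht) x
          simp only [Module.End.mul_apply] at h2
          rw [h2, h1, map_smul]⟩)
      exact ⟨v, hv.1, hv'⟩

variable {ι : Type*} [Fintype ι] [DecidableEq ι]

theorem star_mulVec_dotProduct_mulVec {A : Matrix ι ι ℂ} (hA : A ∈ unitaryGroup ι ℂ)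
    (v w : ι → ℂ) : star (A *ᵥ v) ⬝ᵥ (A *ᵥ w) = star v ⬝ᵥ w := by
  rw [star_mulVec, dotProduct_mulVec, vecMul_vecMul, ← star_eq_conjTranspose, hA.1, vecMul_one]

/-- Commuting unitary matrices have a common unit eigenvector orthogonal to any given, not too
large, family of common eigenvectors. -/
theorem exists_unit_eigenvector_orthogonal {S : Set (Matrix ι ι ℂ)}
    (hS : ∀ A ∈ S, A ∈ unitaryGroup ι ℂ) (hcomm : ∀ A ∈ S, ∀ B ∈ S, A * B = B * A)
    {κ : Type*} [Fintype κ] (hκ : Fintype.card κ < Fintype.card ι) (v : κ → ι → ℂ)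
    (hv : ∀ A ∈ S, ∀ i, ∃ c : Circle, A *ᵥ v i = (c : ℂ) • v i) :
    ∃ w : ι → ℂ, star w ⬝ᵥ w = 1 ∧ (∀ i, star (v i) ⬝ᵥ w = 0) ∧
      ∀ A ∈ S, ∃ c : Circle, A *ᵥ w = (c : ℂ) • w := by
  -- The kernel of `L` is the orthogonal complement of the family: nonzero by dimension, and
  -- invariant since unitary maps preserve orthogonality to eigenvectors.
  let L : (ι → ℂ) →ₗ[ℂ] (κ → ℂ) := Matrix.mulVecLin (Matrix.of fun i => star (v i))
  have hL : ∀ w, w ∈ LinearMap.ker L ↔ ∀ i, star (v i) ⬝ᵥ w = 0 := fun w => by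
    rw [LinearMap.mem_ker, funext_iff]
    rfl
  obtain ⟨w, hw, hw0, hwS⟩ := exists_common_eigenvector (Matrix.mulVecLin '' S)
    (by
      rintro _ ⟨A, hA, rfl⟩ _ ⟨B, hB, rfl⟩
      rw [Module.End.mul_eq_comp, Module.End.mul_eq_comp, ← Matrix.mulVecLin_mul,
        ← Matrix.mulVecLin_mul, hcomm A hA B hB])
    (LinearMap.ker L) (LinearMap.ker_ne_bot_of_finrank_lt (by simpa using hκ))
    (by
      rintro _ ⟨A, hA, rfl⟩ w hw
      rw [hL] at hw ⊢
      intro i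
      obtain ⟨c, hc⟩ := hv A hA i
      have h1 := star_mulVec_dotProduct_mulVec (hS A hA) (v i) w
      rw [hc, hw i, star_smul, smul_dotProduct] at h1
      exact (smul_eq_zero.mp h1).resolve_left (star_ne_zero.mpr (Circle.coe_ne_zero c)))
  rw [hL] at hw
  have hpos : 0 < star w ⬝ᵥ w := dotProduct_star_self_pos_iff.mpr hw0
  obtain ⟨hre, him⟩ := Complex.pos_iff.mp hpos
  let r : ℝ := (star w ⬝ᵥ w).re
  have hr : star w ⬝ᵥ w = (r : ℂ) := Complex.ext rfl him.symm
  let s : ℂ := ((Real.sqrt r)⁻¹ : ℝ)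
  have hs : star s * s * r = 1 := by
    have h2 : Real.sqrt r * Real.sqrt r = r := Real.mul_self_sqrt hre.le
    have h3 : Real.sqrt r ≠ 0 := (Real.sqrt_pos.mpr hre).ne'
    have h4 : (Real.sqrt r)⁻¹ * (Real.sqrt r)⁻¹ * r = 1 := by
      nth_rewrite 3 [← h2]
      field_simp
    simp only [s, Complex.star_def, Complex.conj_ofReal]
    exact_mod_cast h4
  have hu : star (s • w) ⬝ᵥ (s • w) = 1 := by
    rw [star_smul, smul_dotProduct, dotProduct_smul, hr, smul_smul, smul_eq_mul, hs]
  refine ⟨s • w, hu, fun i => by rw [dotProduct_smul, hw i, smul_zero], fun A hA => ?_⟩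
  obtain ⟨c, hc⟩ := hwS _ ⟨A, hA, rfl⟩
  have hc' : A *ᵥ (s • w) = c • (s • w) := by
    rw [mulVec_smul, smul_comm c]
    exact congrArg _ hc
  -- Unitarity preserves the length of the eigenvector, so its eigenvalue has modulus one.
  have h1 := star_mulVec_dotProduct_mulVec (hS A hA) (s • w) (s • w)
  rw [hc', star_smul c, smul_dotProduct, dotProduct_smul, hu, smul_eq_mul, smul_eq_mul,
    mul_one] at h1
  refine ⟨⟨c, ?_⟩, hc'⟩
  refine mem_sphere_zero_iff_norm.mpr ?_
  have h2 : ‖star c * c‖ = 1 := by rw [h1, norm_one]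
  rw [norm_mul, norm_star] at h2
  nlinarith [norm_nonneg c]

end Eigenvectors

/-! ### The unitary group -/

section Unitary

/-- Diagonal unitary matrices. -/
def unitaryDiagonal (n : ℕ) : (Fin n → Circle) →* unitaryGroup (Fin n) ℂ where
  toFun z := ⟨diagonal fun i => (z i : ℂ), by
    rw [mem_unitaryGroup_iff, star_eq_conjTranspose, diagonal_conjTranspose, diagonal_mul_diagonal,
      ← diagonal_one]
    congr 1
    funext i
    simp [Complex.mul_conj]⟩
  map_one' := by ext; simp
  map_mul' z w := by ext; simp [diagonal_mul_diagonal]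

theorem unitaryDiagonal_coe {n : ℕ} (z : Fin n → Circle) :
    (unitaryDiagonal n z : Matrix (Fin n) (Fin n) ℂ) = diagonal fun i => (z i : ℂ) := rfl

theorem unitaryDiagonal_injective (n : ℕ) : Function.Injective (unitaryDiagonal n) :=
  fun _ _ h => funext fun i => Circle.coe_injective
    (congrFun (diagonal_injective (congrArg Subtype.val h)) i)

theorem unitaryDiagonal_continuous (n : ℕ) : Continuous (unitaryDiagonal n) := by
  refine Continuous.subtype_mk (Continuous.matrix_diagonal ?_) _
  fun_prop

/-- A family of commuting unitary matrices has an orthonormal system of common eigenvectors. -/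
theorem exists_orthonormal_eigenvectors {ι : Type*} [Fintype ι] [DecidableEq ι]
    {S : Set (Matrix ι ι ℂ)}
    (hS : ∀ A ∈ S, A ∈ unitaryGroup ι ℂ) (hcomm : ∀ A ∈ S, ∀ B ∈ S, A * B = B * A)
    (m : ℕ) (hm : m ≤ Fintype.card ι) :
    ∃ v : Fin m → ι → ℂ, (∀ i j, star (v i) ⬝ᵥ v j = if i = j then 1 else 0) ∧
      ∀ A ∈ S, ∀ i, ∃ c : Circle, A *ᵥ v i = (c : ℂ) • v i := by
  induction m with
  | zero => exact ⟨fun i => i.elim0, fun i => i.elim0, fun _ _ i => i.elim0⟩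
  | succ m ih =>
    obtain ⟨v, hv, hvS⟩ := ih (by omega)
    obtain ⟨w, hw, hvw, hwS⟩ := exists_unit_eigenvector_orthogonal hS hcomm
      (by simpa using hm) v hvS
    have hwv : ∀ i, star w ⬝ᵥ v i = 0 := fun i => by
      rw [← star_eq_zero, star_dotProduct, star_star, hvw]
    refine ⟨Fin.cons w v, fun i j => ?_, fun A hA i => ?_⟩
    · refine Fin.cases ?_ (fun i => ?_) i <;> refine Fin.cases ?_ (fun j => ?_) j
      · simpa using hw
      · simpa [(Fin.succ_ne_zero _).symm] using hwv j
      · simpa using hvw i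
      · simpa using hv i j
    · refine Fin.cases ?_ (fun i => ?_) i
      · exact hwS A hA
      · exact hvS A hA i

/-- The unitary matrix whose columns form a given orthonormal basis. -/
theorem exists_unitary_of_orthonormal {n : ℕ} {v : Fin n → Fin n → ℂ}
    (hv : ∀ i j, star (v i) ⬝ᵥ v j = if i = j then 1 else 0) :
    ∃ m : unitaryGroup (Fin n) ℂ, ∀ (A : unitaryGroup (Fin n) ℂ) (z : Fin n → Circle),
      (∀ i, A.1 *ᵥ v i = (z i : ℂ) • v i) → m⁻¹ * A * m = unitaryDiagonal n z := by
  let M : Matrix (Fin n) (Fin n) ℂ := (Matrix.of v)ᵀ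
  have hM : M ∈ unitaryGroup (Fin n) ℂ := by
    rw [mem_unitaryGroup_iff']
    ext i j
    rw [one_apply, ← hv i j]
    rfl
  refine ⟨⟨M, hM⟩, fun A z h => ?_⟩
  rw [mul_assoc, inv_mul_eq_iff_eq_mul]
  refine Subtype.ext ?_
  change A.1 * M = M * diagonal fun i => (z i : ℂ)
  ext x i
  rw [mul_diagonal, mul_comm]
  exact congrFun (h i) x

theorem trace_conj_unitary {ι : Type*} [Fintype ι] [DecidableEq ι] (g x : unitaryGroup ι ℂ) :
    (g * x * g⁻¹).1.trace = x.1.trace := by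
  change (g.1 * x.1 * (g⁻¹).1).trace = _
  rw [trace_mul_cycle, show (g⁻¹).1 * g.1 = 1 from congrArg Subtype.val (inv_mul_cancel g), one_mul]

theorem isStandardTorus_unitaryDiagonal (n : ℕ) :
    IsStandardTorus.{u} (unitaryDiagonal n) := by
  have hconj : ∀ S : Set (unitaryGroup (Fin n) ℂ), (∀ x ∈ S, ∀ y ∈ S, x * y = y * x) →
      ∃ g, ∀ x ∈ S, g * x * g⁻¹ ∈ (unitaryDiagonal n).range := fun S hS => by
    obtain ⟨v, hv, hvS⟩ := exists_orthonormal_eigenvectors (S := Subtype.val '' S)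
      (by rintro _ ⟨A, hA, rfl⟩; exact A.2)
      (by
        rintro _ ⟨A, hA, rfl⟩ _ ⟨B, hB, rfl⟩
        exact congrArg Subtype.val (hS A hA B hB)) n (by simp)
    obtain ⟨m, hm⟩ := exists_unitary_of_orthonormal hv
    refine ⟨m⁻¹, fun x hx => ?_⟩
    choose z hz using hvS _ ⟨x, hx, rfl⟩
    exact ⟨z, by rw [inv_inv, hm x z hz]⟩
  refine ⟨unitaryDiagonal_continuous n, unitaryDiagonal_injective n, hconj, ?_⟩
  intro A _ _ f g hfg
  have htr := fun a => conj_invariant_eq_of_joined (τ := fun x => x.1.trace)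
    (unitaryDiagonal_injective n)
    (fun x => (hconj {x} (by rintro _ rfl _ rfl; rfl)).imp fun g hg => hg x rfl)
    (Continuous.matrix_trace continuous_subtype_val) trace_conj_unitary hfg a
  obtain ⟨σ, hσ⟩ := exists_perm_of_sum_character_eq
    (χ := fun i => (Pi.evalMonoidHom _ i).comp f) (ψ := fun i => (Pi.evalMonoidHom _ i).comp g)
    (fun a => by simpa [unitaryDiagonal_coe, trace_diagonal] using htr a)
  -- The permuted standard basis gives the permutation matrix of `σ`.
  obtain ⟨m, hm⟩ := exists_unitary_of_orthonormal
    (v := fun i => Pi.single (σ i) 1) (fun i j => by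
      simp [Pi.single_apply, σ.injective.eq_iff, eq_comm])
  have key : ∀ z, m⁻¹ * unitaryDiagonal n z * m = unitaryDiagonal n (fun i => z (σ i)) := fun z =>
    hm _ _ fun i => by
      rw [unitaryDiagonal_coe]
      ext x
      rw [mulVec_diagonal, Pi.smul_apply, smul_eq_mul, Pi.single_apply]
      split_ifs with h <;> simp [h]
  refine ⟨m⁻¹, fun z => ⟨_, by rw [inv_inv, key z]⟩, fun a => ?_⟩
  rw [inv_inv, key]
  congr 1
  funext i
  exact (DFunLike.congr_fun (hσ i) a).symm

end Unitary

/-! ### The special unitary group -/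

section SpecialUnitary

/-- The inclusion of the special unitary group in the unitary group. -/
def suInclusion (n : ℕ) : specialUnitaryGroup (Fin n) ℂ →* unitaryGroup (Fin n) ℂ :=
  Submonoid.inclusion specialUnitaryGroup_le_unitaryGroup

theorem suInclusion_injective (n : ℕ) : Function.Injective (suInclusion n) :=
  Submonoid.inclusion_injective _

theorem suInclusion_continuous (n : ℕ) : Continuous (suInclusion n) :=
  continuous_subtype_val.subtype_mk _

theorem exists_suInclusion_eq {n : ℕ} {g : unitaryGroup (Fin n) ℂ} (hg : g.1.det = 1) :
    ∃ h, suInclusion n h = g :=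
  ⟨⟨g.1, g.2, hg⟩, rfl⟩

theorem det_unitaryDiagonal {n : ℕ} (z : Fin n → Circle) :
    (unitaryDiagonal n z).1.det = ((∏ i, z i : Circle) : ℂ) := by
  rw [unitaryDiagonal_coe, det_diagonal]
  exact (map_prod Circle.coeHom _ _).symm

/-- Every unitary matrix can be made special by a diagonal factor. -/
theorem exists_unitaryDiagonal_mul_eq {n : ℕ} (g : unitaryGroup (Fin n) ℂ) :
    ∃ z h, suInclusion n h = unitaryDiagonal n z * g := by
  suffices ∃ z : Fin n → Circle, (unitaryDiagonal n z * g).1.det = 1 from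
    this.imp fun z hz => exists_suInclusion_eq hz
  obtain _ | n := n
  · exact ⟨1, by simp⟩
  · have hdet := det_of_mem_unitary g.2
    have hn : ‖g.1.det‖ = 1 := CStarRing.norm_of_mem_unitary hdet
    let d : Circle := ⟨g.1.det, mem_sphere_zero_iff_norm.mpr hn⟩
    -- The inverse determinant is put in the first coordinate, which exists because the size is `n +
    -- 1`.
    refine ⟨Pi.mulSingle 0 d⁻¹, ?_⟩
    change ((unitaryDiagonal (n + 1) _).1 * g.1).det = 1
    rw [det_mul, det_unitaryDiagonal, Finset.prod_pi_mulSingle']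
    simp only [Finset.mem_univ, if_true]
    change ((d⁻¹ : Circle) : ℂ) * (d : ℂ) = 1
    rw [← Circle.coe_mul, inv_mul_cancel, Circle.coe_one]

/-- A parametrization of the tuples on the circle with product one. -/
theorem exists_param_prod_eq_one (n : ℕ) : ∃ (d : ℕ) (ψ : (Fin d → Circle) →* (Fin n → Circle)),
    Continuous ψ ∧ Function.Injective ψ ∧ ∀ w, w ∈ ψ.range ↔ ∏ i, w i = 1 := by
  obtain _ | n := n
  · exact ⟨0, MonoidHom.id _, continuous_id, Function.injective_id, fun w => by simp⟩
  -- The first coordinate is determined by the remaining `n`, which are free.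
  · refine ⟨n, ⟨⟨fun z => Fin.cons (∏ i, z i)⁻¹ z, ?_⟩, ?_⟩, ?_, ?_, ?_⟩
    · funext i
      refine Fin.cases ?_ (fun i => ?_) i <;> simp
    · intro z w
      funext i
      refine Fin.cases ?_ (fun i => ?_) i <;> simp [Finset.prod_mul_distrib, mul_comm]
    · refine continuous_pi fun i => ?_
      refine Fin.cases ?_ (fun i => ?_) i
      · change Continuous fun z : Fin n → Circle => (∏ i, z i)⁻¹
        fun_prop
      · exact continuous_apply i
    · intro z w h
      exact funext fun i => congrFun h i.succ
    · intro w
      constructor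
      · rintro ⟨z, rfl⟩
        simp [Fin.prod_univ_succ]
      · intro h
        refine ⟨fun i => w i.succ, ?_⟩
        funext i
        rw [Fin.prod_univ_succ] at h
        refine Fin.cases ?_ (fun i => ?_) i
        · exact (eq_inv_of_mul_eq_one_left h).symm
        · rfl

/-- A conjugator in $U(n)$ is multiplied by a diagonal matrix to reach determinant one. Diagonal
matrices commute with the torus, so its effect on elements sent into the torus is unchanged. -/
theorem exists_isStandardTorus_specialUnitary (n : ℕ) :
    ∃ (d : ℕ) (φ : (Fin d → Circle) →* specialUnitaryGroup (Fin n) ℂ),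
      IsStandardTorus.{u} φ := by
  obtain ⟨d, ψ, hψc, hψi, hψ⟩ := exists_param_prod_eq_one n
  have hU := isStandardTorus_unitaryDiagonal.{u} n
  let φ : (Fin d → Circle) →* specialUnitaryGroup (Fin n) ℂ :=
    { toFun := fun z => ⟨(unitaryDiagonal n (ψ z)).1, (unitaryDiagonal n (ψ z)).2, by
        refine MonoidHom.mem_mker.mpr ((det_unitaryDiagonal (ψ z)).trans ?_)
        rw [(hψ _).mp ⟨z, rfl⟩, Circle.coe_one]⟩
      map_one' := by ext; simp
      map_mul' := fun z w => Subtype.ext <| congrArg (fun x : unitaryGroup (Fin n) ℂ => x.1) <|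
        (congrArg _ (map_mul ψ z w)).trans (map_mul (unitaryDiagonal n) (ψ z) (ψ w)) }
  have hφ : ∀ z, suInclusion n (φ z) = unitaryDiagonal n (ψ z) := fun _ => rfl
  have hrange : ∀ x, suInclusion n x ∈ (unitaryDiagonal n).range → x ∈ φ.range := by
    rintro x ⟨z, hz⟩
    obtain ⟨w, rfl⟩ := (hψ z).mpr (Circle.coe_injective (by
      rw [← det_unitaryDiagonal, hz]
      exact x.2.2))
    exact ⟨w, suInclusion_injective n ((hφ w).trans hz)⟩
  refine ⟨d, φ, ?_, ?_, ?_, ?_⟩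
  · exact ((continuous_subtype_val.comp hU.continuous).comp hψc).subtype_mk _
  · exact fun z w h => hψi (hU.injective (congrArg (suInclusion n) h))
  · intro S hS
    obtain ⟨g, hg⟩ := hU.exists_conj_mem (suInclusion n '' S) (by
      rintro _ ⟨x, hx, rfl⟩ _ ⟨y, hy, rfl⟩
      rw [← map_mul, hS x hx y hy, map_mul])
    obtain ⟨z, h, hh⟩ := exists_unitaryDiagonal_mul_eq g
    refine ⟨h, fun x hx => hrange _ ?_⟩
    have : suInclusion n (h * x * h⁻¹) =
        unitaryDiagonal n z * (g * suInclusion n x * g⁻¹) * (unitaryDiagonal n z)⁻¹ := by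
      rw [map_mul, map_mul, map_inv, hh]
      group
    rw [this]
    exact mul_mem (mul_mem ⟨z, rfl⟩ (hg _ ⟨x, hx, rfl⟩)) (inv_mem ⟨z, rfl⟩)
  · intro A _ _ f g hfg
    obtain ⟨m, hm, hm'⟩ := hU.exists_conj_eq A (ψ.comp f) (ψ.comp g)
      (hfg.map (continuous_hom_postcomp (suInclusion n) (suInclusion_continuous n)))
    obtain ⟨z, h, hh⟩ := exists_unitaryDiagonal_mul_eq m
    have key : ∀ x, suInclusion n (h * x * h⁻¹) =
        unitaryDiagonal n z * (m * suInclusion n x * m⁻¹) * (unitaryDiagonal n z)⁻¹ := fun x => by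
      rw [map_mul, map_mul, map_inv, hh]
      group
    refine ⟨h, fun w => hrange _ ?_, fun a => suInclusion_injective n ?_⟩
    · rw [key]
      exact mul_mem (mul_mem ⟨z, rfl⟩ (hm _)) (inv_mem ⟨z, rfl⟩)
    · have h1 := hm' a
      simp only [MonoidHom.comp_apply] at h1
      rw [key, hφ, hφ, ← h1, ← map_mul, mul_comm z, map_mul, mul_inv_cancel_right]

end SpecialUnitary

theorem Circle.conj_coe (z : Circle) : starRingEnd ℂ (z : ℂ) = (z : ℂ)⁻¹ := by
  rw [← Circle.coe_inv_eq_conj, Circle.coe_inv]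

/-! ### The compact symplectic group -/

section Symplectic

variable {k : ℕ}

/-- The quaternionic structure on `ℂ ^ 2k`. -/
def quaternionicJ (v : Fin k ⊕ Fin k → ℂ) : Fin k ⊕ Fin k → ℂ := J (Fin k) ℂ *ᵥ star v

theorem quaternionicJ_apply (v : Fin k ⊕ Fin k → ℂ) :
    quaternionicJ v = Sum.elim (fun i => -star (v (Sum.inr i))) (fun i => star (v (Sum.inl i))) := by
  rw [quaternionicJ, J, fromBlocks_mulVec]
  ext i
  cases i <;> simp [neg_mulVec, Function.comp_def]

theorem quaternionicJ_smul (c : ℂ) (v : Fin k ⊕ Fin k → ℂ) :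
    quaternionicJ (c • v) = star c • quaternionicJ v := by
  rw [quaternionicJ, star_smul, mulVec_smul, quaternionicJ]

theorem quaternionicJ_quaternionicJ (v : Fin k ⊕ Fin k → ℂ) :
    quaternionicJ (quaternionicJ v) = -v := by
  ext i
  cases i <;> simp [quaternionicJ_apply]

theorem star_quaternionicJ_dotProduct (v w : Fin k ⊕ Fin k → ℂ) :
    star (quaternionicJ v) ⬝ᵥ quaternionicJ w = star w ⬝ᵥ v := by
  simp only [quaternionicJ_apply, dotProduct, Fintype.sum_sum_type, Pi.star_apply, Sum.elim_inl,
    Sum.elim_inr, star_neg, star_star, neg_mul_neg]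
  rw [add_comm]
  simp only [mul_comm]

/-- This antisymmetry makes every vector orthogonal to its own image under `quaternionicJ`. -/
theorem star_dotProduct_quaternionicJ (v w : Fin k ⊕ Fin k → ℂ) :
    star v ⬝ᵥ quaternionicJ w = -(star w ⬝ᵥ quaternionicJ v) := by
  simp only [quaternionicJ_apply, dotProduct, Fintype.sum_sum_type, Pi.star_apply, Sum.elim_inl,
    Sum.elim_inr, mul_neg, Finset.sum_neg_distrib, neg_add, neg_neg]
  rw [add_comm]
  simp only [mul_comm]

/-- For unitary `A`, the transpose is inverse to the entrywise conjugate, so $AJA^{T}=J$ becomes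
commutation with the quaternionic structure. -/
theorem J_mul_map_star_of_mem {A : unitaryGroup (Fin k ⊕ Fin k) ℂ} (hA : A ∈ compactSp k) :
    A.1 * J (Fin k) ℂ = J (Fin k) ℂ * A.1.map star := by
  have h1 : A.1 * J (Fin k) ℂ * A.1ᵀ = J (Fin k) ℂ := SymplecticGroup.mem_iff.mp hA
  have h2 : A.1ᵀ * A.1.map star = 1 := by
    have := congrArg transpose A.2.1
    rwa [transpose_mul, transpose_one, star_eq_conjTranspose, conjTranspose,
      ← transpose_map, transpose_transpose] at this
  rw [← h1, mul_assoc _ A.1ᵀ, h2, mul_one, h1]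

theorem mem_compactSp_of_J_mul_map_star {A : unitaryGroup (Fin k ⊕ Fin k) ℂ}
    (h : A.1 * J (Fin k) ℂ = J (Fin k) ℂ * A.1.map star) : A ∈ compactSp k := by
  refine SymplecticGroup.mem_iff.mpr ?_
  have h2 : A.1.map star * A.1ᵀ = 1 := by
    have := congrArg transpose A.2.2
    rwa [transpose_mul, transpose_one, star_eq_conjTranspose, conjTranspose,
      ← transpose_map, transpose_transpose] at this
  rw [h, mul_assoc, h2, mul_one]

theorem mulVec_quaternionicJ {A : unitaryGroup (Fin k ⊕ Fin k) ℂ} (hA : A ∈ compactSp k)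
    (v : Fin k ⊕ Fin k → ℂ) : A.1 *ᵥ quaternionicJ v = quaternionicJ (A.1 *ᵥ v) := by
  have : star (A.1 *ᵥ v) = A.1.map star *ᵥ star v := by
    rw [star_mulVec, ← mulVec_transpose, conjTranspose, ← transpose_map, transpose_transpose]
  rw [quaternionicJ, quaternionicJ, this, mulVec_mulVec, mulVec_mulVec, J_mul_map_star_of_mem hA]

/-- Diagonal elements of the compact symplectic group. -/
def spDiagonal (k : ℕ) : (Fin k → Circle) →* compactSp k where
  toFun z := ⟨⟨diagonal (Sum.elim (fun i => (z i : ℂ)) fun i => star (z i : ℂ)), by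
    rw [mem_unitaryGroup_iff, star_eq_conjTranspose, diagonal_conjTranspose, diagonal_mul_diagonal,
      ← diagonal_one]
    congr 1
    funext i
    cases i <;> simp [Circle.conj_coe]⟩, by
    apply mem_compactSp_of_J_mul_map_star
    rw [diagonal_map (star_zero ℂ)]
    ext i j
    rw [diagonal_mul, mul_diagonal]
    cases i <;> cases j <;> simp [J, one_apply] <;> split_ifs <;> simp_all⟩
  map_one' := by
    refine Subtype.ext (Subtype.ext ?_)
    change diagonal _ = (1 : Matrix (Fin k ⊕ Fin k) (Fin k ⊕ Fin k) ℂ)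
    rw [← diagonal_one]
    congr 1
    funext i
    cases i <;> simp
  map_mul' z w := by
    refine Subtype.ext (Subtype.ext ?_)
    change diagonal _ = diagonal _ * diagonal _
    rw [diagonal_mul_diagonal]
    congr 1
    funext i
    cases i <;> simp

theorem spDiagonal_coe (z : Fin k → Circle) :
    (spDiagonal k z).1.1 = diagonal (Sum.elim (fun i => (z i : ℂ)) fun i => star (z i : ℂ)) := rfl

theorem spDiagonal_injective (k : ℕ) : Function.Injective (spDiagonal k) :=
  fun _ _ h => funext fun i => Circle.coe_injective <|
    congrFun (diagonal_injective (congrArg (fun x : compactSp k => x.1.1) h)) (Sum.inl i)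

theorem spDiagonal_continuous (k : ℕ) : Continuous (spDiagonal k) := by
  refine Continuous.subtype_mk (Continuous.subtype_mk (Continuous.matrix_diagonal ?_) _) _
  refine continuous_pi fun i => ?_
  cases i <;> simp only [Sum.elim_inl, Sum.elim_inr] <;> fun_prop

/-- A family of commuting elements of `Sp(k)` has a quaternionic orthonormal system of common
eigenvectors. -/
theorem exists_quaternionic_orthonormal_eigenvectors {S : Set (compactSp k)}
    (hcomm : ∀ A ∈ S, ∀ B ∈ S, A * B = B * A) (m : ℕ) (hm : m ≤ k) :
    ∃ v : Fin m → Fin k ⊕ Fin k → ℂ, (∀ i j, star (v i) ⬝ᵥ v j = if i = j then 1 else 0) ∧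
      (∀ i j, star (v i) ⬝ᵥ quaternionicJ (v j) = 0) ∧
      ∀ A ∈ S, ∀ i, ∃ c : Circle, A.1.1 *ᵥ v i = (c : ℂ) • v i := by
  induction m with
  | zero => exact ⟨fun i => i.elim0, fun i => i.elim0, fun i => i.elim0, fun _ _ i => i.elim0⟩
  | succ m ih =>
    obtain ⟨v, hv, hvJ, hvS⟩ := ih (by omega)
    obtain ⟨w, hw, hvw, hwS⟩ := exists_unit_eigenvector_orthogonal
      (S := (fun A : compactSp k => A.1.1) '' S)
      (by rintro _ ⟨A, hA, rfl⟩; exact A.1.2)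
      (by
        rintro _ ⟨A, hA, rfl⟩ _ ⟨B, hB, rfl⟩
        exact congrArg (fun A : compactSp k => A.1.1) (hcomm A hA B hB))
      -- The new vector must avoid each $v_i$ and each $Jv_i$; these are $2m<2k$ vectors, and $Jv_i$
      -- is an eigenvector with the conjugate eigenvalue.
      (κ := Fin m ⊕ Fin m) (by simp; omega) (Sum.elim v fun i => quaternionicJ (v i))
      (by
        rintro _ ⟨A, hA, rfl⟩ i
        cases i with
        | inl i => exact hvS A hA i
        | inr i =>
          obtain ⟨c, hc⟩ := hvS A hA i
          refine ⟨c⁻¹, ?_⟩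
          simp only [Sum.elim_inr]
          rw [mulVec_quaternionicJ A.2, hc, quaternionicJ_smul, Circle.coe_inv_eq_conj]
          rfl)
    have hvw1 : ∀ i, star (v i) ⬝ᵥ w = 0 := fun i => hvw (Sum.inl i)
    have hvw2 : ∀ i, star (quaternionicJ (v i)) ⬝ᵥ w = 0 := fun i => hvw (Sum.inr i)
    have hwv : ∀ i, star w ⬝ᵥ v i = 0 := fun i => by
      rw [← star_eq_zero, star_dotProduct, star_star, hvw1]
    have hwJv : ∀ i, star w ⬝ᵥ quaternionicJ (v i) = 0 := fun i => by
      rw [← star_eq_zero, star_dotProduct, star_star, hvw2]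
    refine ⟨Fin.cons w v, fun i j => ?_, fun i j => ?_, fun A hA i => ?_⟩
    · refine Fin.cases ?_ (fun i => ?_) i <;> refine Fin.cases ?_ (fun j => ?_) j
      · simpa using hw
      · simpa [(Fin.succ_ne_zero _).symm] using hwv j
      · simpa using hvw1 i
      · simpa using hv i j
    · refine Fin.cases ?_ (fun i => ?_) i <;> refine Fin.cases ?_ (fun j => ?_) j
      · exact self_eq_neg.mp (star_dotProduct_quaternionicJ w w)
      · exact hwJv j
      · exact (star_dotProduct_quaternionicJ (v i) w).trans (by rw [hwJv, neg_zero])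
      · exact hvJ i j
    · refine Fin.cases ?_ (fun i => ?_) i
      · exact hwS _ ⟨A, hA, rfl⟩
      · exact hvS A hA i

/-- The symplectic unitary matrix given by a quaternionic orthonormal basis. -/
theorem exists_compactSp_of_orthonormal {v : Fin k → Fin k ⊕ Fin k → ℂ}
    (hv : ∀ i j, star (v i) ⬝ᵥ v j = if i = j then 1 else 0)
    (hvJ : ∀ i j, star (v i) ⬝ᵥ quaternionicJ (v j) = 0) :
    ∃ m : compactSp k, ∀ (A : compactSp k) (z : Fin k → Circle),
      (∀ i, A.1.1 *ᵥ v i = (z i : ℂ) • v i) → m⁻¹ * A * m = spDiagonal k z := by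
  let u : Fin k ⊕ Fin k → Fin k ⊕ Fin k → ℂ := Sum.elim v fun i => quaternionicJ (v i)
  let M : Matrix (Fin k ⊕ Fin k) (Fin k ⊕ Fin k) ℂ := (Matrix.of u)ᵀ
  have hM : M ∈ unitaryGroup (Fin k ⊕ Fin k) ℂ := by
    rw [mem_unitaryGroup_iff']
    ext i j
    change star (u i) ⬝ᵥ u j = _
    rw [one_apply]
    cases i <;> cases j <;> simp only [u, Sum.elim_inl, Sum.elim_inr, Sum.inl.injEq, Sum.inr.injEq,
      reduceCtorEq, if_false]
    · exact hv _ _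
    · exact hvJ _ _
    · rw [← star_eq_zero, star_dotProduct, star_star, hvJ]
    · rw [star_quaternionicJ_dotProduct, hv]
      simp only [eq_comm]
  have hMS : (⟨M, hM⟩ : unitaryGroup (Fin k ⊕ Fin k) ℂ) ∈ compactSp k := by
    apply mem_compactSp_of_J_mul_map_star
    have hcol : ∀ i, (J (Fin k) ℂ * M.map star).col i = quaternionicJ (u i) := fun i => rfl
    ext x i
    change _ = (J (Fin k) ℂ * M.map star).col i x
    rw [hcol]
    -- Multiplication by `J` sends column $v_i$ to $Jv_i$ and column $Jv_i$ to $-v_i=J(Jv_i)$.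
    cases i with
    | inl i => simp [mul_apply, Fintype.sum_sum_type, J, M, u, one_apply]
    | inr i =>
      simp [mul_apply, Fintype.sum_sum_type, J, M, u, one_apply, quaternionicJ_quaternionicJ]
  refine ⟨⟨⟨M, hM⟩, hMS⟩, fun A z h => ?_⟩
  rw [mul_assoc, inv_mul_eq_iff_eq_mul]
  refine Subtype.ext (Subtype.ext ?_)
  change A.1.1 * M = M * diagonal _
  ext x i
  rw [mul_diagonal, mul_comm]
  cases i with
  | inl i => exact congrFun (h i) x
  | inr i =>
    have := mulVec_quaternionicJ A.2 (v i)
    rw [h i, quaternionicJ_smul] at this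
    exact congrFun this x

theorem isStandardTorus_spDiagonal (k : ℕ) : IsStandardTorus.{u} (spDiagonal k) := by
  have hconj : ∀ S : Set (compactSp k), (∀ x ∈ S, ∀ y ∈ S, x * y = y * x) →
      ∃ g, ∀ x ∈ S, g * x * g⁻¹ ∈ (spDiagonal k).range := fun S hS => by
    obtain ⟨v, hv, hvJ, hvS⟩ := exists_quaternionic_orthonormal_eigenvectors hS k le_rfl
    obtain ⟨m, hm⟩ := exists_compactSp_of_orthonormal hv hvJ
    refine ⟨m⁻¹, fun x hx => ?_⟩
    choose z hz using hvS x hx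
    exact ⟨z, by rw [inv_inv, hm x z hz]⟩
  refine ⟨spDiagonal_continuous k, spDiagonal_injective k, hconj, ?_⟩
  intro A _ _ f g hfg
  have htr := fun a => conj_invariant_eq_of_joined (τ := fun x : compactSp k => x.1.1.trace)
    (spDiagonal_injective k)
    (fun x => (hconj {x} (by rintro _ rfl _ rfl; rfl)).imp fun g hg => hg x rfl)
    (Continuous.matrix_trace (continuous_subtype_val.comp continuous_subtype_val))
    (fun g x => trace_conj_unitary g.1 x.1) hfg a
  obtain ⟨σ, hσ⟩ := exists_perm_of_sum_character_add_inv_eq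
    (χ := fun i => (Pi.evalMonoidHom _ i).comp f) (ψ := fun i => (Pi.evalMonoidHom _ i).comp g)
    (fun a => by
      have := htr a
      simp only [MonoidHom.comp_apply, spDiagonal_coe, trace_diagonal, Fintype.sum_sum_type,
        Sum.elim_inl, Sum.elim_inr] at this
      simpa [Finset.sum_add_distrib, Circle.conj_coe] using this)
  -- The index `p i` selects the basis vector $e_{\sigma(i)}$ or its quaternionic partner, according
  -- to whether the character was kept or inverted.
  have hp : ∀ i, ∃ p : Fin k ⊕ Fin k, (p = Sum.inl (σ i) ∨ p = Sum.inr (σ i)) ∧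
      ∀ a, (g a i : ℂ) =
        (Sum.elim (fun i => (f a i : ℂ)) (fun i => star (f a i : ℂ)) : Fin k ⊕ Fin k → ℂ) p :=
    fun i => by
      rcases hσ i with h | h
      · exact ⟨_, Or.inl rfl, fun a => congrArg ((↑) : Circle → ℂ) (DFunLike.congr_fun h a)⟩
      · refine ⟨_, Or.inr rfl, fun a => ?_⟩
        refine (congrArg ((↑) : Circle → ℂ) (DFunLike.congr_fun h a)).trans ?_
        simp [Circle.conj_coe]
  choose p hpσ hpf using hp
  let r : Fin k ⊕ Fin k → Fin k := Sum.elim id id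
  have hr : ∀ i, r (p i) = σ i := fun i => by
    rcases hpσ i with h | h <;> rw [h] <;> rfl
  have hpinj : ∀ i j, p i = p j ↔ i = j := fun i j =>
    ⟨fun h => σ.injective (by rw [← hr, ← hr, h]), fun h => by rw [h]⟩
  have hJs : ∀ q : Fin k ⊕ Fin k, ∃ c : ℂ,
      quaternionicJ (Pi.single q 1) = Pi.single q.swap c := fun q => by
    rcases q with q | q
    · refine ⟨1, ?_⟩
      ext x
      cases x <;> simp [quaternionicJ_apply, Pi.single_apply, apply_ite (star : ℂ → ℂ)]
    · refine ⟨-1, ?_⟩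
      ext x
      cases x <;> simp [quaternionicJ_apply, Pi.single_apply, apply_ite (star : ℂ → ℂ),
        apply_ite (Neg.neg : ℂ → ℂ)]
  -- No two chosen basis vectors are quaternionic partners, since `σ` is injective; this gives the
  -- orthogonality needed for a signed permutation matrix in $Sp(k)$.
  have hswap : ∀ i j, p i ≠ (p j).swap := fun i j h => by
    have h1 : σ i = σ j := by
      rw [← hr, ← hr, h]
      cases p j <;> rfl
    rw [σ.injective h1] at h
    cases hq : p j <;> rw [hq] at h <;> simp at h
  obtain ⟨m, hm⟩ := exists_compactSp_of_orthonormal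
    (v := fun i => Pi.single (p i) 1) (fun i j => by
      simp [Pi.single_apply, hpinj, eq_comm]) (fun i j => by
      obtain ⟨c, hc⟩ := hJs (p j)
      rw [hc]
      simp [hswap i j])
  let q : (Fin k → Circle) → Fin k ⊕ Fin k → Circle := fun z => Sum.elim z z⁻¹
  have hq : ∀ z, (Sum.elim (fun i => (z i : ℂ)) fun i => star (z i : ℂ)) =
      fun i => (q z i : ℂ) := fun z => by
    funext i
    cases i <;> simp [q, Circle.conj_coe]
  have key : ∀ z, m⁻¹ * spDiagonal k z * m = spDiagonal k (fun i => q z (p i)) := fun z =>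
    hm _ _ fun i => by
      rw [spDiagonal_coe, hq]
      ext x
      rw [mulVec_diagonal, Pi.smul_apply, smul_eq_mul, Pi.single_apply]
      split_ifs with h <;> simp [h]
  refine ⟨m⁻¹, fun z => ⟨_, by rw [inv_inv, key z]⟩, fun a => ?_⟩
  rw [inv_inv, key]
  congr 1
  funext i
  refine Circle.coe_injective ?_
  rw [hpf, hq]

end Symplectic

/-! ### Assembly for the class of products -/

theorem InClassP.exists_isStandardTorus {G : Type*} [Group G] [TopologicalSpace G]
    (hG : InClassP G) :
    T2Space G ∧ ∃ (ι : Type) (_ : Finite ι) (φ : (ι → Circle) →* G), IsStandardTorus.{u} φ := by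
  obtain ⟨a, b, c, r, q, k, ⟨e⟩⟩ := hG
  refine ⟨e.symm.toHomeomorph.t2Space, ?_⟩
  choose d φ hφ using fun i => exists_isStandardTorus_specialUnitary.{u} (r i)
  obtain ⟨Φ₁, h₁⟩ := IsStandardTorus.pi hφ
  obtain ⟨Φ₂, h₂⟩ := IsStandardTorus.pi fun i => isStandardTorus_unitaryDiagonal.{u} (q i)
  obtain ⟨Φ₃, h₃⟩ := IsStandardTorus.pi fun i => isStandardTorus_spDiagonal.{u} (k i)
  obtain ⟨Φ₄, h₄⟩ := h₂.prod h₃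
  obtain ⟨Φ, h⟩ := h₁.prod h₄
  exact ⟨_, inferInstance, _, h.map e.symm⟩

theorem mainTheorem5 {G : Type*} [Group G] [TopologicalSpace G] [IsTopologicalGroup G]
    (hG : InClassP G) (T : MaximalTorus G)
    {π : Type*} [CommGroup π] {A : Type*} [CommGroup A] [Finite A] (n : ℕ)
    (e : π ≃* Multiplicative (Fin n → ℤ) × A) :
    Finite (A →* T.toSubgroup) ∧
    Finite (ZerothHomotopy (π →* G)) ∧
    Nat.card (ZerothHomotopy (π →* G)) =
      Nat.card (MulAction.orbitRel.Quotient T.WeylGroup (A →* T.toSubgroup)) := by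
  obtain ⟨_, ι, _, φ, hφ⟩ := hG.exists_isStandardTorus
  obtain ⟨ψ, hψ, hT⟩ := T.exists_isStandardTorus hφ
  exact card_zerothHomotopy_hom T hψ hT e
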